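/- A \emph{picture} over a finite alphabet $A$ is a function $p:\{0,\dots,m-1\}\times\{0,\dots,n-1\}\to A$ with $m,n\ge 1$; its \emph{shape} is $(m,n)$, with $m$ horizontal. Let $\#\notin A$, and let $\hat p:\{0,\dots,m+1\}\times\{0,\dots,n+1\}\to A\cup\{\#\}$ be $p$ (shifted by $(1,1)$) surrounded by a frame of $\#$'s. A \emph{domino language} over $A$ is the set of all pictures $p$ such that $\hat p$ contains none of the patterns from a given set of forbidden horizontal ($2\times 1$) and vertical ($1\times 2$) patterns over $A\cup\{\#\}$. A picture language is \emph{recognizable} if it is the image of a domino language over a finite alphabet under a symbolwise projection. A set $S\subseteq\mathbb{Z}_+^2$ is \emph{recognizable} if the set of all pictures over a fixed one-letter alphabet with shape in $S$ is a recognizable picture language. The \emph{epigraph} of $f:\mathbb{Z}_+\to\mathbb{Z}_+$ is $\{(m,n)\in\mathbb{Z}_+^2 : n\ge f(m)\}$. Write $f\approx g$ if $f(n)/g(n)\to 1$ as $n\to\infty$. \textbf{Proposition.} For every positive rational number $r$ there is a function $f:\mathbb{Z}_+\to\mathbb{Z}_+$ with $f(n)\approx n^r$ whose epigraph is recognizable.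 More explicitly, whenever $r=a/b$ with integers $a,b\ge 1$, the function $f(n)=\lfloor n^{1/b}\rfloor^a$ satisfies $f(n)\approx n^r$ and has a recognizable epigraph. -/

import Mathlib

open Filter Topology

namespace PictureLanguage

/-- A (nonempty) picture over the alphabet `A`: a function `⟦m⟧ × ⟦n⟧ → A` with `m, n ≥ 1`.
The first coordinate is horizontal, the second one is vertical (increasing upward). -/
structure Picture (A : Type) where
  width : ℕ+
  height : ℕ+
  cell : Fin width → Fin height → A

namespace Picture

variable {A B : Type}

/-- The shape `(m, n)` of a picture. -/
def shape (p : Picture A) : ℕ+ × ℕ+ := (p.width, p.height)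

/-- Apply a map of alphabets (a symbolwise projection) to every cell of a picture. -/
def map (π : A → B) (p : Picture A) : Picture B where
  width := p.width
  height := p.height
  cell := fun i j => π (p.cell i j)

/-- The padded picture. The boundary symbol is `none`, the symbols of `A` are `some a`.
Only the values on `{0, …, m+1} × {0, …, n+1}` are meant to be used; the original picture is
found at `{1, …, m} × {1, …, n}`, and the frame around it carries the boundary symbol. -/
def pad (p : Picture A) (i j : ℕ) : Option A :=
  if h : (1 ≤ i ∧ i ≤ p.width) ∧ (1 ≤ j ∧ j ≤ p.height) then
    some (p.cell ⟨i - 1, by omega⟩ ⟨j - 1, by omega⟩)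
  else
    none

/-- The unique picture of shape `(m, n)` over the one-letter alphabet `Unit`. -/
def una (m n : ℕ+) : Picture Unit where
  width := m
  height := n
  cell := fun _ _ => ()

end Picture

/-- A set of forbidden dominoes over `A ∪ {none}`. A horizontal domino `(x, y)` has `y` to the
right of `x`; a vertical domino `(x, y)` has `y` above `x`. -/
structure ForbiddenDominoes (A : Type) where
  horizontal : Set (Option A × Option A)
  vertical : Set (Option A × Option A)

/-- The domino language: all pictures whose padded picture contains no forbidden domino. -/
def ForbiddenDominoes.language {A : Type} (F : ForbiddenDominoes A) : Set (Picture A) :=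
  {p | (∀ i j : ℕ, i + 1 < p.width + 2 → j < p.height + 2 →
          (p.pad i j, p.pad (i + 1) j) ∉ F.horizontal) ∧
       (∀ i j : ℕ, i < p.width + 2 → j + 1 < p.height + 2 →
          (p.pad i j, p.pad i (j + 1)) ∉ F.vertical)}

/-- A picture language is a domino language if it is given by forbidden dominoes. -/
def IsDominoLanguage {A : Type} (L : Set (Picture A)) : Prop :=
  ∃ F : ForbiddenDominoes A, L = F.language

/-- The class REC: images of domino languages over finite alphabets under symbolwise projections.
(As symbolwise projections compose, this is the closure of the class of domino languages under
symbolwise projections.) -/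
def IsRecognizable {A : Type} (L : Set (Picture A)) : Prop :=
  ∃ (B : Type) (_ : Finite B) (K : Set (Picture B)) (π : B → A),
    IsDominoLanguage K ∧ L = Picture.map π '' K

/-- A set `S` of pairs of positive integers is recognizable if the one-letter picture language
`{una(m, n) | (m, n) ∈ S}` is recognizable. -/
def IsRecognizableSet (S : Set (ℕ+ × ℕ+)) : Prop :=
  IsRecognizable {p : Picture Unit | ∃ m n : ℕ+, (m, n) ∈ S ∧ p = Picture.una m n}

/-- The epigraph of `f`: all pairs `(m, n)` with `n ≥ f(m)`. -/
def epigraph (f : ℕ+ → ℕ+) : Set (ℕ+ × ℕ+) := {x | f x.1 ≤ x.2}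

/-- `f ≈ g`: the quotient `f(n) / g(n)` tends to `1` as `n → ∞`. -/
def AsympEqual (f g : ℕ+ → ℝ) : Prop :=
  Tendsto (fun n => f n / g n) atTop (𝓝 1)

end PictureLanguage

namespace PictureLanguage

/-! A shape `(m, n)` lies in the epigraph iff some `k` satisfies `k ^ a ≤ n` and `m < (k + 1) ^ b`,
since `⌊m ^ (1 / b)⌋` is the least `k` with the second property (`floorRootPow_le_iff`). So it
suffices to guess `k` and check both inequalities by local constraints.

The guess is a set of marked columns together with a set of marked rows. An injection of the marked
rows into the marked columns is locally checkable, and this one comparison of the two sizes is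
enough, by monotonicity.

Powers come from base-`β` counting. If the rows of `R` are dealt out to the `k` marked columns, and
in every column the marks keep pace with the rows of `R'` up to one, then `k * |R'| ≤ |R|` and `|R|
+ 1 ≤ (k + 1) * (|R'| + 1)` (`CountStep.le`). Iterating `a` times from all rows to a nonempty set
gives `k ^ a ≤ n`; iterating `b` times in the transposed picture, from all columns to the empty set,
gives `m + 1 ≤ (k + 1) ^ b`. Conversely, multiples of powers of `k` or `k + 1` realize such chains
(`countStep_of_pow`). Everything is assembled from closure properties of `Rec`. -/

/-- Nearest-neighbour constraints on a labelled rectangle: on the cells of its four sides, and on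
pairs of horizontally or vertically adjacent cells. -/
structure Tiles (B : Type) where
  left : B → Prop
  right : B → Prop
  bot : B → Prop
  top : B → Prop
  hor : B → B → Prop
  ver : B → B → Prop

/-- The restriction of the labelling `l` to `{0, …, m-1} × {0, …, n-1}` obeys the constraints. -/
structure Tiles.Ok {B : Type} (T : Tiles B) (m n : ℕ) (l : ℕ → ℕ → B) : Prop where
  left : ∀ j < n, T.left (l 0 j)
  right : ∀ j < n, T.right (l (m - 1) j)
  bot : ∀ i < m, T.bot (l i 0)
  top : ∀ i < m, T.top (l i (n - 1))
  hor : ∀ i j, i + 1 < m → j < n → T.hor (l i j) (l (i + 1) j)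
  ver : ∀ i j, i < m → j + 1 < n → T.ver (l i j) (l i (j + 1))

/-- A property of labelled rectangles is recognizable if it is defined by nearest-neighbour
constraints on the labels and one additional finite layer. -/
def Rec {B : Type} (P : ℕ → ℕ → (ℕ → ℕ → B) → Prop) : Prop :=
  ∃ (C : Type) (_ : Finite C) (T : Tiles (B × C)), ∀ m n : ℕ, 0 < m → 0 < n →
    ∀ l : ℕ → ℕ → B, P m n l ↔ ∃ g : ℕ → ℕ → C, T.Ok m n (fun i j => (l i j, g i j))

/-! ### Closure under conjunction, relabelling, transposition and quantification over layers. -/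

namespace Rec

variable {B D : Type} {P Q : ℕ → ℕ → (ℕ → ℕ → B) → Prop}

theorem iff (h : Rec P) (hPQ : ∀ m n, 0 < m → 0 < n → ∀ l, Q m n l ↔ P m n l) : Rec Q := by
  obtain ⟨C, hC, T, hT⟩ := h
  exact ⟨C, hC, T, fun m n hm hn l => (hPQ m n hm hn l).trans (hT m n hm hn l)⟩

theorem congr (h : Rec P) {m n : ℕ} (hm : 0 < m) (hn : 0 < n) {l l' : ℕ → ℕ → B}
    (hl : ∀ i < m, ∀ j < n, l i j = l' i j) (hP : P m n l) : P m n l' := by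
  obtain ⟨C, hC, T, hT⟩ := h
  obtain ⟨g, hg⟩ := (hT m n hm hn l).1 hP
  refine (hT m n hm hn l').2 ⟨g, ?_, ?_, ?_, ?_, ?_, ?_⟩
  · intro j hj; rw [← hl 0 hm j hj]; exact hg.left j hj
  · intro j hj; rw [← hl _ (by omega) j hj]; exact hg.right j hj
  · intro i hi; rw [← hl i hi 0 hn]; exact hg.bot i hi
  · intro i hi; rw [← hl i hi _ (by omega)]; exact hg.top i hi
  · intro i j hi hj; rw [← hl i (by omega) j hj, ← hl _ hi j hj]; exact hg.hor i j hi hj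
  · intro i j hi hj; rw [← hl i hi j (by omega), ← hl i hi _ hj]; exact hg.ver i j hi hj

theorem and (hP : Rec P) (hQ : Rec Q) : Rec (fun m n l => P m n l ∧ Q m n l) := by
  obtain ⟨C, hC, T, hT⟩ := hP
  obtain ⟨C', hC', T', hT'⟩ := hQ
  refine ⟨C × C', inferInstance,
    ⟨fun x => T.left (x.1, x.2.1) ∧ T'.left (x.1, x.2.2),
     fun x => T.right (x.1, x.2.1) ∧ T'.right (x.1, x.2.2),
     fun x => T.bot (x.1, x.2.1) ∧ T'.bot (x.1, x.2.2),
     fun x => T.top (x.1, x.2.1) ∧ T'.top (x.1, x.2.2),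
     fun x y => T.hor (x.1, x.2.1) (y.1, y.2.1) ∧ T'.hor (x.1, x.2.2) (y.1, y.2.2),
     fun x y => T.ver (x.1, x.2.1) (y.1, y.2.1) ∧ T'.ver (x.1, x.2.2) (y.1, y.2.2)⟩, ?_⟩
  intro m n hm hn l
  refine (and_congr (hT m n hm hn l) (hT' m n hm hn l)).trans ⟨?_, ?_⟩
  · rintro ⟨⟨g, h⟩, g', h'⟩
    exact ⟨fun i j => (g i j, g' i j), fun j hj => ⟨h.left j hj, h'.left j hj⟩,
      fun j hj => ⟨h.right j hj, h'.right j hj⟩, fun j hj => ⟨h.bot j hj, h'.bot j hj⟩,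
      fun j hj => ⟨h.top j hj, h'.top j hj⟩,
      fun i j hi hj => ⟨h.hor i j hi hj, h'.hor i j hi hj⟩,
      fun i j hi hj => ⟨h.ver i j hi hj, h'.ver i j hi hj⟩⟩
  · rintro ⟨g, h⟩
    exact ⟨⟨fun i j => (g i j).1, fun j hj => (h.left j hj).1, fun j hj => (h.right j hj).1,
        fun j hj => (h.bot j hj).1, fun j hj => (h.top j hj).1,
        fun i j hi hj => (h.hor i j hi hj).1, fun i j hi hj => (h.ver i j hi hj).1⟩,
      ⟨fun i j => (g i j).2, fun j hj => (h.left j hj).2, fun j hj => (h.right j hj).2,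
        fun j hj => (h.bot j hj).2, fun j hj => (h.top j hj).2,
        fun i j hi hj => (h.hor i j hi hj).2, fun i j hi hj => (h.ver i j hi hj).2⟩⟩

theorem comap (hP : Rec P) (f : D → B) : Rec (fun m n l => P m n (fun i j => f (l i j))) := by
  obtain ⟨C, hC, T, hT⟩ := hP
  refine ⟨C, hC, ⟨fun x => T.left (f x.1, x.2), fun x => T.right (f x.1, x.2),
    fun x => T.bot (f x.1, x.2), fun x => T.top (f x.1, x.2),
    fun x y => T.hor (f x.1, x.2) (f y.1, y.2), fun x y => T.ver (f x.1, x.2) (f y.1, y.2)⟩, ?_⟩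
  intro m n hm hn l
  refine (hT m n hm hn _).trans ?_
  exact ⟨fun ⟨g, h⟩ => ⟨g, h.1, h.2, h.3, h.4, h.5, h.6⟩,
    fun ⟨g, h⟩ => ⟨g, h.1, h.2, h.3, h.4, h.5, h.6⟩⟩

theorem transpose (hP : Rec P) : Rec (fun m n l => P n m (fun i j => l j i)) := by
  obtain ⟨C, hC, T, hT⟩ := hP
  refine ⟨C, hC, ⟨T.bot, T.top, T.left, T.right, T.ver, T.hor⟩, ?_⟩
  intro m n hm hn l
  refine (hT n m hn hm _).trans ?_
  exact ⟨fun ⟨g, h⟩ => ⟨fun i j => g j i, h.3, h.4, h.1, h.2, fun i j hi hj => h.6 j i hj hi,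
      fun i j hi hj => h.5 j i hj hi⟩,
    fun ⟨g, h⟩ => ⟨fun i j => g j i, h.3, h.4, h.1, h.2, fun i j hi hj => h.6 j i hj hi,
      fun i j hi hj => h.5 j i hj hi⟩⟩

theorem ex [Finite D] {P : ℕ → ℕ → (ℕ → ℕ → B × D) → Prop} (hP : Rec P) :
    Rec (fun m n l => ∃ d : ℕ → ℕ → D, P m n (fun i j => (l i j, d i j))) := by
  obtain ⟨C, hC, T, hT⟩ := hP
  refine ⟨D × C, inferInstance,
    ⟨fun x => T.left ((x.1, x.2.1), x.2.2), fun x => T.right ((x.1, x.2.1), x.2.2),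
      fun x => T.bot ((x.1, x.2.1), x.2.2), fun x => T.top ((x.1, x.2.1), x.2.2),
      fun x y => T.hor ((x.1, x.2.1), x.2.2) ((y.1, y.2.1), y.2.2),
      fun x y => T.ver ((x.1, x.2.1), x.2.2) ((y.1, y.2.1), y.2.2)⟩, ?_⟩
  intro m n hm hn l
  constructor
  · rintro ⟨d, hd⟩
    obtain ⟨g, h⟩ := (hT m n hm hn _).1 hd
    exact ⟨fun i j => (d i j, g i j), h.1, h.2, h.3, h.4, h.5, h.6⟩
  · rintro ⟨g, h⟩
    exact ⟨fun i j => (g i j).1, (hT m n hm hn _).2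
      ⟨fun i j => (g i j).2, h.1, h.2, h.3, h.4, h.5, h.6⟩⟩

theorem tilesOk (T : Tiles B) : Rec (fun m n l => T.Ok m n l) := by
  refine ⟨Unit, inferInstance, ⟨fun x => T.left x.1, fun x => T.right x.1, fun x => T.bot x.1,
    fun x => T.top x.1, fun x y => T.hor x.1 y.1, fun x y => T.ver x.1 y.1⟩, ?_⟩
  intro m n hm hn l
  exact ⟨fun h => ⟨fun _ _ => (), h.1, h.2, h.3, h.4, h.5, h.6⟩,
    fun ⟨g, h⟩ => ⟨h.1, h.2, h.3, h.4, h.5, h.6⟩⟩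

/-- Equality of vertically adjacent labels forces a guessed layer to depend on the column only. -/
theorem exCol [Finite D] {P : ℕ → ℕ → (ℕ → ℕ → B × D) → Prop} (hP : Rec P) :
    Rec (fun m n l => ∃ c : ℕ → D, P m n (fun i j => (l i j, c i))) := by
  refine (hP.and (tilesOk ⟨fun _ => True, fun _ => True, fun _ => True, fun _ => True,
    fun _ _ => True, fun x y => x.2 = y.2⟩)).ex.iff fun m n hm hn l => ⟨?_, ?_⟩
  · rintro ⟨c, hc⟩
    exact ⟨fun i _ => c i, hc, by constructor <;> simp⟩
  · rintro ⟨d, hd, hT⟩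
    -- The layer is constant on columns only inside the rectangle, so `congr` is needed to replace
    -- it by its bottom row.
    refine ⟨fun i => d i 0, hP.congr hm hn (fun i hi j hj => ?_) hd⟩
    have : d i j = d i 0 := by
      induction j with
      | zero => rfl
      | succ j ih => rw [← ih (by omega)]; exact (hT.ver i j hi hj).symm
    rw [this]

theorem exRow [Finite D] {P : ℕ → ℕ → (ℕ → ℕ → B × D) → Prop} (hP : Rec P) :
    Rec (fun m n l => ∃ r : ℕ → D, P m n (fun i j => (l i j, r j))) :=
  hP.transpose.exCol.transpose

/-! ### Locally checkable conditions on single rows. -/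

theorem forall_cells (p : B → Prop) : Rec (fun m n l => ∀ i < m, ∀ j < n, p (l i j)) := by
  refine (tilesOk ⟨p, fun _ => True, fun _ => True, fun _ => True, fun _ y => p y,
    fun _ _ => True⟩).iff fun m n hm hn l => ⟨?_, ?_⟩
  · intro h
    constructor <;> simp_all
  · intro h i hi j hj
    cases i with
    | zero => exact h.left j hj
    | succ i => exact h.hor i j hi hj

/-- An extra bit carries the promise that a suitable cell is here or further right. It is set on the
left side, passed on until fulfilled, and cannot remain open on the right side. -/
theorem row_exists (p : B → Bool) : Rec (fun m n l => ∀ j < n, ∃ i < m, p (l i j)) := by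
  refine (tilesOk (B := B × Bool) ⟨fun x => x.2, fun x => x.2 → p x.1, fun _ => True, fun _ => True,
    fun x y => x.2 → p x.1 ∨ y.2, fun _ _ => True⟩).ex.iff fun m n hm hn l => ⟨?_, ?_⟩
  · intro h
    classical
    refine ⟨fun i j => decide (∃ x < m, i ≤ x ∧ p (l x j)), ⟨?_, ?_, ?_, ?_, ?_, ?_⟩⟩
    · intro j hj
      simpa using h j hj
    · intro j hj hx
      obtain ⟨x, hx, hx', hp⟩ := of_decide_eq_true hx
      obtain rfl : x = m - 1 := by omega
      exact hp
    · simp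
    · simp
    · intro i j hi hj hx
      obtain ⟨x, hx, hx', hp⟩ := of_decide_eq_true hx
      rcases hx'.eq_or_lt with rfl | hlt
      · exact .inl hp
      · exact .inr (decide_eq_true ⟨x, hx, hlt, hp⟩)
    · simp
  · rintro ⟨d, hd⟩ j hj
    by_contra! hne
    have key : ∀ i < m, d i j = true := by
      intro i
      induction i with
      | zero => exact fun _ => hd.left j hj
      | succ i ih =>
        intro hi
        exact (hd.hor i j hi hj (ih (by omega))).resolve_left (hne i (by omega))
    exact hne _ (by omega) (hd.right j hj (key _ (by omega)))

/-- The difference of the two prefix counts is always 0 or 1, so one bit per cell can store it and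
adjacent cells can check its update. -/
theorem row_balanced (p q : B → Bool) : Rec (fun m n l => ∀ j < n, ∀ k ≤ m,
    ∑ i ∈ Finset.range k, (q (l i j)).toNat ≤ ∑ i ∈ Finset.range k, (p (l i j)).toNat ∧
    ∑ i ∈ Finset.range k, (p (l i j)).toNat ≤ ∑ i ∈ Finset.range k, (q (l i j)).toNat + 1) := by
  refine (tilesOk (B := B × Bool)
    ⟨fun x => (p x.1).toNat = (q x.1).toNat + x.2.toNat, fun _ => True, fun _ => True,
      fun _ => True, fun x y => x.2.toNat + (p y.1).toNat = (q y.1).toNat + y.2.toNat,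
      fun _ _ => True⟩).ex.iff fun m n hm hn l => ⟨?_, ?_⟩
  · intro h
    have key : ∀ i < m, ∀ j < n, ∑ x ∈ Finset.range (i + 1), (p (l x j)).toNat =
        ∑ x ∈ Finset.range (i + 1), (q (l x j)).toNat +
        (decide (∑ x ∈ Finset.range (i + 1), (p (l x j)).toNat ≠
          ∑ x ∈ Finset.range (i + 1), (q (l x j)).toNat)).toNat := by
      intro i hi j hj
      have := h j hj (i + 1) hi
      by_cases he : ∑ x ∈ Finset.range (i + 1), (p (l x j)).toNat =
          ∑ x ∈ Finset.range (i + 1), (q (l x j)).toNat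
      · simp [he]
      · simp only [ne_eq, he, not_false_eq_true, decide_true, Bool.toNat_true]
        omega
    refine ⟨fun i j => decide (∑ x ∈ Finset.range (i + 1), (p (l x j)).toNat ≠
      ∑ x ∈ Finset.range (i + 1), (q (l x j)).toNat), ⟨?_, ?_, ?_, ?_, ?_, ?_⟩⟩
    · intro j hj
      simpa using key 0 hm j hj
    · simp
    · simp
    · simp
    · intro i j hi hj
      have h1 := key i (by omega) j hj
      have h2 := key (i + 1) hi j hj
      simp only [Finset.sum_range_succ _ (i + 1)] at h2 ⊢
      omega
    · simp
  · rintro ⟨d, hd⟩ j hj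
    have key : ∀ i < m, ∑ x ∈ Finset.range (i + 1), (p (l x j)).toNat =
        ∑ x ∈ Finset.range (i + 1), (q (l x j)).toNat + (d i j).toNat := by
      intro i
      induction i with
      | zero => intro _; simpa using hd.left j hj
      | succ i ih =>
        intro hi
        have h1 := ih (by omega)
        have h2 := hd.hor i j hi hj
        simp only [Finset.sum_range_succ _ (i + 1)] at h2 ⊢
        omega
    intro k hk
    cases k with
    | zero => simp
    | succ k =>
      have h1 := key k hk
      have h2 := Bool.toNat_le (d k j)
      omega

end Rec

/-! ### Translation to domino languages. -/

theorem Picture.pad_succ {A : Type} (p : Picture A) (i j : ℕ) (hi : i < p.width)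
    (hj : j < p.height) : p.pad (i + 1) (j + 1) = some (p.cell ⟨i, hi⟩ ⟨j, hj⟩) := by
  unfold Picture.pad
  rw [dif_pos ⟨⟨by omega, by omega⟩, by omega, by omega⟩]
  rfl

theorem Picture.pad_eq_none {A : Type} (p : Picture A) (i j : ℕ)
    (h : i = 0 ∨ j = 0 ∨ (p.width : ℕ) < i ∨ (p.height : ℕ) < j) : p.pad i j = none := by
  unfold Picture.pad
  rw [dif_neg (by omega)]

/-- The dominoes over the padded alphabet that violate given constraints. -/
def violations {B : Type} (out into : B → Prop) (rel : B → B → Prop) :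
    Set (Option B × Option B) :=
  {x | (∃ b, x = (none, some b) ∧ ¬ into b) ∨ (∃ b, x = (some b, none) ∧ ¬ out b) ∨
    ∃ b b', x = (some b, some b') ∧ ¬ rel b b'}

section violations

variable {B : Type} (out into : B → Prop) (rel : B → B → Prop) (b b' : B)

@[simp] theorem none_none_mem_violations : ¬ (none, none) ∈ violations out into rel := by
  simp [violations]

@[simp] theorem none_some_mem_violations :
    (none, some b) ∈ violations out into rel ↔ ¬ into b := by
  simp [violations]

@[simp] theorem some_none_mem_violations :
    (some b, none) ∈ violations out into rel ↔ ¬ out b := by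
  simp [violations]

@[simp] theorem some_some_mem_violations :
    (some b, some b') ∈ violations out into rel ↔ ¬ rel b b' := by
  simp [violations]

end violations

/-- Dominoes with exactly one frame symbol encode the constraints on the sides, and those without
frame symbols encode adjacency; a domino of two frame symbols is always allowed. -/
theorem isRecognizableSet_of_rec {S : Set (ℕ+ × ℕ+)} {P : ℕ → ℕ → (ℕ → ℕ → Unit) → Prop}
    (hP : Rec P) (hS : ∀ m n : ℕ+, (m, n) ∈ S ↔ P m n (fun _ _ => ())) :
    IsRecognizableSet S := by
  obtain ⟨C, hC, T, hT⟩ := hP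
  refine ⟨Unit × C, inferInstance,
    ForbiddenDominoes.language ⟨violations T.right T.left T.hor, violations T.top T.bot T.ver⟩,
    fun _ => (), ⟨_, rfl⟩, ?_⟩
  ext p
  constructor
  · rintro ⟨m, n, hmn, rfl⟩
    rw [hS, hT m n m.pos n.pos] at hmn
    obtain ⟨g, hg⟩ := hmn
    have hm := m.pos
    have hn := n.pos
    refine ⟨⟨m, n, fun i j => ((), g i j)⟩, ⟨?_, ?_⟩, rfl⟩
    · intro i j hi hj
      dsimp only at hi hj
      rcases Nat.eq_zero_or_pos j with rfl | hj0
      · rw [Picture.pad_eq_none _ _ _ (by simp), Picture.pad_eq_none _ _ _ (by simp)]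
        simp
      obtain ⟨j, rfl⟩ : ∃ j', j = j' + 1 := ⟨j - 1, by omega⟩
      by_cases hjn : (n : ℕ) < j + 1
      · rw [Picture.pad_eq_none _ _ _ (by simp [hjn]), Picture.pad_eq_none _ _ _ (by simp [hjn])]
        simp
      rcases Nat.eq_zero_or_pos i with rfl | hi0
      · rw [Picture.pad_eq_none _ _ _ (by simp),
          Picture.pad_succ _ _ _ (by exact hm) (by dsimp only; omega)]
        simpa using hg.left j (by omega)
      obtain ⟨i, rfl⟩ : ∃ i', i = i' + 1 := ⟨i - 1, by omega⟩
      rw [Picture.pad_succ _ i _ (by dsimp only; omega) (by dsimp only; omega)]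
      by_cases him : i + 1 < m
      · rw [Picture.pad_succ _ (i + 1) _ him (by dsimp only; omega)]
        simpa using hg.hor i j him (by omega)
      · rw [Picture.pad_eq_none _ (i + 1 + 1) _ (by dsimp only; omega)]
        obtain rfl : i = m - 1 := by omega
        simpa using hg.right j (by omega)
    · intro i j hi hj
      dsimp only at hi hj
      rcases Nat.eq_zero_or_pos i with rfl | hi0
      · rw [Picture.pad_eq_none _ _ _ (by simp), Picture.pad_eq_none _ _ _ (by simp)]
        simp
      obtain ⟨i, rfl⟩ : ∃ i', i = i' + 1 := ⟨i - 1, by omega⟩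
      by_cases hin : (m : ℕ) < i + 1
      · rw [Picture.pad_eq_none _ _ _ (by simp [hin]), Picture.pad_eq_none _ _ _ (by simp [hin])]
        simp
      rcases Nat.eq_zero_or_pos j with rfl | hj0
      · rw [Picture.pad_eq_none _ _ _ (by simp),
          Picture.pad_succ _ _ _ (by dsimp only; omega) (by exact hn)]
        simpa using hg.bot i (by omega)
      obtain ⟨j, rfl⟩ : ∃ j', j = j' + 1 := ⟨j - 1, by omega⟩
      rw [Picture.pad_succ _ _ j (by dsimp only; omega) (by dsimp only; omega)]
      by_cases hjn : j + 1 < n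
      · rw [Picture.pad_succ _ _ (j + 1) (by dsimp only; omega) hjn]
        simpa using hg.ver i j (by omega) hjn
      · rw [Picture.pad_eq_none _ _ (j + 1 + 1) (by dsimp only; omega)]
        obtain rfl : j = n - 1 := by omega
        simpa using hg.top i (by omega)
  · rintro ⟨⟨m, n, g⟩, ⟨hH, hV⟩, rfl⟩
    dsimp only at hH hV
    have hm := m.pos
    have hn := n.pos
    refine ⟨m, n, ?_, rfl⟩
    rw [hS, hT m n m.pos n.pos]
    have hlab : ∀ (i j : ℕ) (hi : i < m) (hj : j < n), ((), if h : i < m ∧ j < n then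
        (g ⟨i, h.1⟩ ⟨j, h.2⟩).2 else (g ⟨0, hm⟩ ⟨0, hn⟩).2) = g ⟨i, hi⟩ ⟨j, hj⟩ := by
      intro i j hi hj
      rw [dif_pos ⟨hi, hj⟩]
    -- Outside the rectangle the layer takes the value of the corner cell, which no constraint sees.
    refine ⟨fun i j => if h : i < m ∧ j < n then (g ⟨i, h.1⟩ ⟨j, h.2⟩).2
      else (g ⟨0, hm⟩ ⟨0, hn⟩).2, ?_, ?_, ?_, ?_, ?_, ?_⟩
    · intro j hj
      rw [hlab 0 j hm hj]
      have := hH 0 (j + 1) (by omega) (by omega)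
      rw [Picture.pad_eq_none _ _ _ (by simp), Picture.pad_succ _ _ _ (by exact hm) hj] at this
      simpa using this
    · intro j hj
      rw [hlab _ j (by omega) hj]
      have := hH (m - 1 + 1) (j + 1) (by omega) (by omega)
      rw [Picture.pad_succ _ _ _ (by dsimp only; omega) hj,
        Picture.pad_eq_none _ _ _ (by dsimp only; omega)] at this
      simpa using this
    · intro i hi
      rw [hlab i 0 hi hn]
      have := hV (i + 1) 0 (by omega) (by omega)
      rw [Picture.pad_eq_none _ _ _ (by simp), Picture.pad_succ _ _ _ hi (by exact hn)] at this
      simpa using this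
    · intro i hi
      rw [hlab i _ hi (by omega)]
      have := hV (i + 1) (n - 1 + 1) (by omega) (by omega)
      rw [Picture.pad_succ _ _ _ hi (by dsimp only; omega),
        Picture.pad_eq_none _ _ _ (by dsimp only; omega)] at this
      simpa using this
    · intro i j hi hj
      rw [hlab i j (by omega) hj, hlab _ j hi hj]
      have := hH (i + 1) (j + 1) (by omega) (by omega)
      rw [Picture.pad_succ _ i _ (by dsimp only; omega) hj, Picture.pad_succ _ (i + 1) _ hi hj]
        at this
      simpa using this
    · intro i j hi hj
      rw [hlab i j hi (by omega), hlab i _ hi hj]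
      have := hV (i + 1) (j + 1) (by omega) (by omega)
      rw [Picture.pad_succ _ _ j hi (by dsimp only; omega), Picture.pad_succ _ _ (j + 1) hi hj]
        at this
      simpa using this
namespace Rec

variable {B : Type}

theorem row_atMostOne (p : B → Bool) :
    Rec (fun m n l => ∀ j < n, ∑ i ∈ Finset.range m, (p (l i j)).toNat ≤ 1) := by
  refine (row_balanced p fun _ => false).iff fun m n hm hn l => ⟨fun h j hj k hk => ?_,
    fun h j hj => by simpa using (h j hj m le_rfl).2⟩
  simpa using (Finset.sum_le_sum_of_subset (by simpa using hk)).trans (h j hj)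

end Rec

/-! ### Multiplication and powers by distributing rows over columns. -/

/-- One step of base-`β` counting, where the number of columns in `C` is `β` or `β - 1`: the rows in
`R'` are to be every `β`-th row of `R`, and the layer `p` distributes the rows of `R` over the
columns in `C`. -/
def CountStep (m n : ℕ) (C R R' : ℕ → ℕ → Bool) : Prop :=
  ∃ p : ℕ → ℕ → Bool,
    (∀ i < m, ∀ j < n, (!p i j || (C i j && R i j)) = true) ∧
    (∀ j < n, ∑ i ∈ Finset.range m, (p i j).toNat ≤ 1) ∧
    (∀ j < n, ∃ i < m, (p i j || !R i j || R' i j) = true) ∧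
    (∀ i < m, ∀ k ≤ n,
      ∑ j ∈ Finset.range k, (R' i j && C i j).toNat ≤ ∑ j ∈ Finset.range k, (p i j).toNat ∧
      ∑ j ∈ Finset.range k, (p i j).toNat ≤
        ∑ j ∈ Finset.range k, (R' i j && C i j).toNat + 1)

theorem rec_countStep : Rec (B := (Bool × Bool) × Bool) (fun m n l =>
    CountStep m n (fun i j => (l i j).1.1) (fun i j => (l i j).1.2) (fun i j => (l i j).2)) :=
  (((Rec.forall_cells (B := ((Bool × Bool) × Bool) × Bool)
      fun x => (!x.2 || (x.1.1.1 && x.1.1.2)) = true).and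
    ((Rec.row_atMostOne fun x : ((Bool × Bool) × Bool) × Bool => x.2).and
    ((Rec.row_exists fun x : ((Bool × Bool) × Bool) × Bool => x.2 || !x.1.1.2 || x.1.2).and
    (Rec.row_balanced (fun x : ((Bool × Bool) × Bool) × Bool => x.2)
      (fun x => x.1.2 && x.1.1.1)).transpose)))).ex

/-- Starting from the rows in `R`, `t` counting steps lead to a set of rows with property `E`. -/
def CountChain (E : ℕ → ℕ → (ℕ → ℕ → Bool) → Prop) (m n : ℕ) (C : ℕ → ℕ → Bool) :
    ℕ → (ℕ → ℕ → Bool) → Prop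
  | 0, R => E m n R
  | t + 1, R => ∃ r : ℕ → Bool,
      CountStep m n C R (fun _ j => r j) ∧ CountChain E m n C t (fun _ j => r j)

theorem rec_countChain {E : ℕ → ℕ → (ℕ → ℕ → Bool) → Prop} (hE : Rec E) (t : ℕ) :
    Rec (B := Bool × Bool) (fun m n l =>
      CountChain E m n (fun i j => (l i j).1) t (fun i j => (l i j).2)) := by
  induction t with
  | zero => exact hE.comap Prod.snd
  | succ t ih =>
    exact (rec_countStep.and (ih.comap fun x : (Bool × Bool) × Bool => (x.1.1, x.2))).exRow

/-- Double counting of the marks `p`: each column of `C` contains `|R'|` or `|R'| + 1` of them and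
other columns none, while each row of `R` has at most one, and exactly one if it is not in `R'`. -/
theorem CountStep.le {m n : ℕ} {c r r' : ℕ → Bool}
    (h : CountStep m n (fun i _ => c i) (fun _ j => r j) (fun _ j => r' j)) :
    (∑ i ∈ Finset.range m, (c i).toNat) * ∑ j ∈ Finset.range n, (r' j).toNat ≤
        ∑ j ∈ Finset.range n, (r j).toNat ∧
      ∑ j ∈ Finset.range n, (r j).toNat + 1 ≤
        (∑ i ∈ Finset.range m, (c i).toNat + 1) * (∑ j ∈ Finset.range n, (r' j).toNat + 1) := by
  obtain ⟨p, hp, hone, hex, hbal⟩ := h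
  have hand : ∀ i, ∑ j ∈ Finset.range n, (r' j && c i).toNat =
      (c i).toNat * ∑ j ∈ Finset.range n, (r' j).toNat := by
    intro i
    cases c i <;> simp
  constructor
  · calc _ = ∑ i ∈ Finset.range m, (c i).toNat * ∑ j ∈ Finset.range n, (r' j).toNat :=
          Finset.sum_mul _ _ _
      _ ≤ ∑ i ∈ Finset.range m, ∑ j ∈ Finset.range n, (p i j).toNat := by
          refine Finset.sum_le_sum fun i hi => ?_
          rw [← hand]
          exact (hbal i (Finset.mem_range.1 hi) n le_rfl).1
      _ = ∑ j ∈ Finset.range n, ∑ i ∈ Finset.range m, (p i j).toNat := Finset.sum_comm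
      _ ≤ _ := by
          refine Finset.sum_le_sum fun j hj => ?_
          rw [Finset.mem_range] at hj
          cases hr : r j with
          | true => exact hone j hj
          | false =>
            rw [Finset.sum_eq_zero]
            · simp
            · intro i hi
              have := hp i (Finset.mem_range.1 hi) j hj
              simp_all
  · have h1 : ∑ j ∈ Finset.range n, (r j).toNat ≤ ∑ j ∈ Finset.range n,
        ((r' j).toNat + ∑ i ∈ Finset.range m, (p i j).toNat) := by
      refine Finset.sum_le_sum fun j hj => ?_
      obtain ⟨i, hi, hi'⟩ := hex j (Finset.mem_range.1 hj)
      have h2 : (p i j).toNat ≤ ∑ i ∈ Finset.range m, (p i j).toNat :=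
        Finset.single_le_sum (f := fun i => (p i j).toNat) (fun _ _ => Nat.zero_le _)
          (Finset.mem_range.2 hi)
      refine le_trans ?_ (Nat.add_le_add_left h2 _)
      revert hi'
      dsimp only
      cases r j <;> cases r' j <;> cases p i j <;> simp
    have h2 : ∑ i ∈ Finset.range m, ∑ j ∈ Finset.range n, (p i j).toNat ≤
        ∑ i ∈ Finset.range m, (c i).toNat * (∑ j ∈ Finset.range n, (r' j).toNat + 1) := by
      refine Finset.sum_le_sum fun i hi => ?_
      rw [Finset.mem_range] at hi
      have h3 := (hbal i hi n le_rfl).2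
      rw [hand] at h3
      cases hc : c i with
      | true => simpa [hc] using h3
      | false =>
        rw [Finset.sum_eq_zero]
        · simp
        · intro j hj
          have := hp i hi j (Finset.mem_range.1 hj)
          simp_all
    rw [Finset.sum_add_distrib, Finset.sum_comm] at h1
    rw [← Finset.sum_mul] at h2
    linarith

theorem CountChain.mul_le {E : ℕ → ℕ → (ℕ → ℕ → Bool) → Prop} {m n : ℕ} {c : ℕ → Bool} {t : ℕ}
    {r : ℕ → Bool} (h : CountChain E m n (fun i _ => c i) t (fun _ j => r j)) :
    ∃ e : ℕ → Bool, E m n (fun _ j => e j) ∧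
      (∑ i ∈ Finset.range m, (c i).toNat) ^ t * ∑ j ∈ Finset.range n, (e j).toNat ≤
        ∑ j ∈ Finset.range n, (r j).toNat ∧
      ∑ j ∈ Finset.range n, (r j).toNat + 1 ≤
        (∑ i ∈ Finset.range m, (c i).toNat + 1) ^ t *
          (∑ j ∈ Finset.range n, (e j).toNat + 1) := by
  induction t generalizing r with
  | zero => exact ⟨r, h, by simp⟩
  | succ t ih =>
    obtain ⟨r', hs, hc⟩ := h
    obtain ⟨e, he, h1, h2⟩ := ih hc
    refine ⟨e, he, ?_, ?_⟩
    · rw [pow_succ', mul_assoc]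
      exact (Nat.mul_le_mul_left _ h1).trans hs.le.1
    · rw [pow_succ', mul_assoc]
      exact hs.le.2.trans (Nat.mul_le_mul_left _ h2)

theorem sum_toNat_dvd (d k : ℕ) :
    ∑ j ∈ Finset.range k, (decide (d ∣ j + 1)).toNat = k / d := by
  induction k with
  | zero => simp
  | succ k ih =>
    rw [Finset.sum_range_succ, ih, Nat.succ_div]
    by_cases h : d ∣ k + 1 <;> simp [h]

/-- The expression `x / β + (if i + 1 ≤ x % β then 1 else 0)` counts the numbers in `1, …, x`
congruent to `i + 1` modulo `β`; for `i + 1 = β` the second term vanishes. -/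
theorem succ_div_mod (x β i : ℕ) (hi : i < β) :
    (x + 1) / β + (if i + 1 ≤ (x + 1) % β then 1 else 0) =
      x / β + (if i + 1 ≤ x % β then 1 else 0) +
        (if (x + 1) % β = (i + 1) % β then 1 else 0) := by
  have hβ : 0 < β := by omega
  have h1 := Nat.div_add_mod x β
  have h2 := Nat.mod_lt x hβ
  generalize x / β = q at *
  generalize x % β = s at *
  subst h1
  rcases Nat.lt_or_ge (s + 1) β with hs | hs
  · rw [add_assoc, Nat.mul_add_div hβ, Nat.mul_add_mod, Nat.div_eq_of_lt hs, Nat.mod_eq_of_lt hs]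
    rcases Nat.lt_or_ge (i + 1) β with hi' | hi'
    · rw [Nat.mod_eq_of_lt hi']
      split_ifs <;> omega
    · obtain rfl : β = i + 1 := by omega
      rw [Nat.mod_self]
      rw [if_neg (by omega), if_neg (by omega), if_neg (by omega)]
  · obtain rfl : β = s + 1 := by omega
    rw [add_assoc, Nat.mul_add_div hβ, Nat.mul_add_mod, Nat.div_self hβ, Nat.mod_self]
    rcases Nat.lt_or_ge (i + 1) (s + 1) with hi' | hi'
    · rw [Nat.mod_eq_of_lt hi']
      rw [if_neg (by omega), if_pos (by omega), if_neg (by omega)]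
    · obtain rfl : s = i := by omega
      rw [Nat.mod_self]
      split_ifs <;> omega

theorem sum_toNat_residue (d β i k : ℕ) (hi : i < β) :
    ∑ j ∈ Finset.range k,
        (decide (d ∣ j + 1) && decide ((j + 1) / d % β = (i + 1) % β)).toNat =
      k / d / β + (if i + 1 ≤ k / d % β then 1 else 0) := by
  induction k with
  | zero => simp
  | succ k ih =>
    rw [Finset.sum_range_succ, ih]
    by_cases h : d ∣ k + 1
    · rw [Nat.succ_div, if_pos h, succ_div_mod _ _ _ hi]
      simp only [h, decide_true, Bool.true_and, Nat.add_left_cancel_iff]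
      split_ifs <;> simp [*]
    · rw [Nat.succ_div, if_neg h]
      simp [h]

/-- The `x`-th multiple of `β ^ s` is sent to the column `i` with `x ≡ i + 1` modulo `β`. For `β =
k` the rows of `R'` go to the last column; for `β = k + 1` they receive no mark. -/
theorem countStep_of_pow {m n k β : ℕ} (s : ℕ) (hk : 0 < k) (hkm : k ≤ m) (hkβ : k ≤ β)
    (hβk : β ≤ k + 1) :
    CountStep m n (fun i _ => decide (i < k)) (fun _ j => decide (β ^ s ∣ j + 1))
      (fun _ j => decide (β ^ (s + 1) ∣ j + 1)) := by
  have hβ : 0 < β := by omega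
  refine ⟨fun i j => decide (i < k) && (decide (β ^ s ∣ j + 1) &&
    decide ((j + 1) / β ^ s % β = (i + 1) % β)), ?_, ?_, ?_, ?_⟩
  · intro i _ j _
    by_cases h1 : i < k <;> by_cases h2 : β ^ s ∣ j + 1 <;> simp [h1, h2]
  · intro j _
    -- As `k ≤ β`, the `k` columns have distinct residues.
    have hinj : ∀ x < k, ∀ y < k, (x + 1) % β = (y + 1) % β → x = y := by
      intro x hx y hy h
      have := Nat.ModEq.add_right_cancel' (n := β) 1 h
      rwa [Nat.ModEq, Nat.mod_eq_of_lt (by omega), Nat.mod_eq_of_lt (by omega)] at this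
    simp only [Bool.toNat, Bool.cond_eq_ite, Bool.and_eq_true, decide_eq_true_eq]
    rw [← Finset.sum_filter, ← Finset.card_eq_sum_ones, Finset.card_le_one]
    intro x hx y hy
    simp only [Finset.mem_filter] at hx hy
    exact hinj x hx.2.1 y hy.2.1 (hx.2.2.2.symm.trans hy.2.2.2)
  · intro j _
    by_cases h1 : β ^ s ∣ j + 1
    · by_cases h2 : β ^ (s + 1) ∣ j + 1
      · exact ⟨0, by omega, by simp [h2]⟩
      · have h3 : (j + 1) / β ^ s % β ≠ 0 := by
          intro h
          apply h2
          rw [pow_succ]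
          exact (Nat.dvd_div_iff_mul_dvd h1).1 (Nat.dvd_of_mod_eq_zero h)
        have h4 := Nat.mod_lt ((j + 1) / β ^ s) hβ
        -- A nonzero residue has a column, because `β ≤ k + 1`.
        refine ⟨(j + 1) / β ^ s % β - 1, by omega, ?_⟩
        have h5 : (j + 1) / β ^ s % β - 1 < k := by omega
        dsimp only
        rw [Nat.sub_add_cancel (by omega), Nat.mod_mod]
        simp [h1, h5]
    · exact ⟨0, by omega, by simp [h1]⟩
  · intro i _ l _
    by_cases hi : i < k
    · simp only [hi, decide_true, Bool.true_and, Bool.and_true]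
      -- The two prefix counts differ exactly by the indicator in `sum_toNat_residue`.
      rw [sum_toNat_dvd, sum_toNat_residue _ _ _ _ (by omega), pow_succ, Nat.div_div_eq_div_mul]
      split_ifs <;> omega
    · simp [hi]

theorem countChain_of_pow {E : ℕ → ℕ → (ℕ → ℕ → Bool) → Prop} {m n k β : ℕ} (hk : 0 < k)
    (hkm : k ≤ m) (hkβ : k ≤ β) (hβk : β ≤ k + 1) (t s : ℕ)
    (hE : E m n (fun _ j => decide (β ^ (s + t) ∣ j + 1))) :
    CountChain E m n (fun i _ => decide (i < k)) t (fun _ j => decide (β ^ s ∣ j + 1)) := by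
  induction t generalizing s with
  | zero => exact hE
  | succ t ih =>
    exact ⟨_, countStep_of_pow s hk hkm hkβ hβk, ih (s + 1) (by rwa [add_assoc, add_comm 1])⟩

/-! ### Comparison of marked rows with marked columns, and the two power inequalities. -/

/-- The rows in `R` are injectively assigned to columns in `C`. -/
def RowsInject (m n : ℕ) (C R : ℕ → ℕ → Bool) : Prop :=
  ∃ p : ℕ → ℕ → Bool, (∀ j < n, ∃ i < m, ((p i j && C i j) || !R i j) = true) ∧
    ∀ i < m, ∑ j ∈ Finset.range n, (p i j && C i j).toNat ≤ 1

theorem rec_rowsInject : Rec (B := Bool × Bool) (fun m n l =>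
    RowsInject m n (fun i j => (l i j).1) (fun i j => (l i j).2)) :=
  ((Rec.row_exists (B := (Bool × Bool) × Bool) fun x => (x.2 && x.1.1) || !x.1.2).and
    (Rec.row_atMostOne fun x : (Bool × Bool) × Bool => x.2 && x.1.1).transpose).ex

theorem RowsInject.le {m n : ℕ} {c r : ℕ → Bool}
    (h : RowsInject m n (fun i _ => c i) (fun _ j => r j)) :
    ∑ j ∈ Finset.range n, (r j).toNat ≤ ∑ i ∈ Finset.range m, (c i).toNat := by
  obtain ⟨p, hex, hone⟩ := h
  calc _ ≤ ∑ j ∈ Finset.range n, ∑ i ∈ Finset.range m, (p i j && c i).toNat := by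
        refine Finset.sum_le_sum fun j hj => ?_
        obtain ⟨i, hi, hi'⟩ := hex j (Finset.mem_range.1 hj)
        refine le_trans ?_ (Finset.single_le_sum (f := fun i => (p i j && c i).toNat)
          (fun _ _ => Nat.zero_le _) (Finset.mem_range.2 hi))
        revert hi'
        dsimp only
        cases (p i j && c i) <;> cases r j <;> simp
    _ = ∑ i ∈ Finset.range m, ∑ j ∈ Finset.range n, (p i j && c i).toNat := Finset.sum_comm
    _ ≤ _ := by
        refine Finset.sum_le_sum fun i hi => ?_
        have := hone i (Finset.mem_range.1 hi)
        revert this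
        dsimp only
        cases c i <;> simp

theorem rowsInject_of_lt {m n k : ℕ} (hm : 0 < m) (hk : k ≤ m) :
    RowsInject m n (fun i _ => decide (i < k)) (fun _ j => decide (j < k)) := by
  refine ⟨fun i j => decide (i = j), fun j _ => ?_, fun i _ => ?_⟩
  · by_cases h : j < k
    · exact ⟨j, by omega, by simp [h]⟩
    · exact ⟨0, hm, by simp [h]⟩
  · refine le_trans (b := ∑ j ∈ Finset.range n, if i = j then 1 else 0) ?_ ?_
    · refine Finset.sum_le_sum fun j _ => ?_
      by_cases h : i = j <;> simp [h, Bool.toNat_le]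
    · rw [Finset.sum_ite_eq]
      split_ifs <;> simp

/-- The tileable form of the condition `k ^ a ≤ n ∧ m < (k + 1) ^ b` for some `k`. -/
def PowerCondition (a b m n : ℕ) : Prop :=
  ∃ c r : ℕ → Bool, RowsInject m n (fun i _ => c i) (fun _ j => r j) ∧
    CountChain (fun m n R => ∀ i < m, ∃ j < n, R i j = true) m n (fun i _ => c i) a
      (fun _ _ => true) ∧
    CountChain (fun m n R => ∀ i < m, ∀ j < n, R i j = false) n m (fun j _ => r j) b
      (fun _ _ => true)

theorem rec_powerCondition (a b : ℕ) :
    Rec (B := Unit) (fun m n _ => PowerCondition a b m n) := by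
  have h1 := rec_countChain (Rec.row_exists (B := Bool) id).transpose a
  have h2 := (rec_countChain (Rec.forall_cells (B := Bool) fun x => x = false) b).transpose
  have h := (rec_rowsInject.comap fun x : (Unit × Bool) × Bool => (x.1.2, x.2)).and
    ((h1.comap fun x : (Unit × Bool) × Bool => (x.1.2, true)).and
      (h2.comap fun x : (Unit × Bool) × Bool => (x.2, true)))
  exact h.exRow.exCol

/-- The number extracted from a labelling is that of marked rows: the second chain uses it directly,
the first bounds the power of the possibly larger number of marked columns. -/
theorem powerCondition_iff {a b m n : ℕ} (ha : 0 < a) (hb : 0 < b) (hm : 0 < m) (hn : 0 < n) :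
    PowerCondition a b m n ↔ ∃ k, k ^ a ≤ n ∧ m < (k + 1) ^ b := by
  constructor
  · rintro ⟨c, r, hinj, hca, hcb⟩
    obtain ⟨e, he, h1, -⟩ := hca.mul_le
    obtain ⟨e', he', -, h2⟩ := hcb.mul_le
    refine ⟨∑ j ∈ Finset.range n, (r j).toNat, ?_, ?_⟩
    · obtain ⟨j, hj, hej⟩ := he 0 hm
      have h3 : (e j).toNat ≤ ∑ j ∈ Finset.range n, (e j).toNat :=
        Finset.single_le_sum (f := fun j => (e j).toNat) (fun _ _ => Nat.zero_le _)
          (Finset.mem_range.2 hj)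
      calc _ ≤ (∑ i ∈ Finset.range m, (c i).toNat) ^ a := Nat.pow_le_pow_left hinj.le a
        _ ≤ _ := Nat.le_mul_of_pos_right _ (by simp_all; omega)
        _ ≤ _ := h1
        _ = n := by simp
    · have h3 : ∑ i ∈ Finset.range m, (e' i).toNat = 0 :=
        Finset.sum_eq_zero fun i hi => by simp [he' 0 hn i (Finset.mem_range.1 hi)]
      rw [h3] at h2
      simpa using h2
  · rintro ⟨k₀, h⟩
    -- Marking `k` columns requires `k ≤ m`; a larger witness can be replaced by `m`, as `m < (m +
    -- 1) ^ b`.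
    obtain ⟨k, ⟨hka, hkb⟩, hkm⟩ : ∃ k, (k ^ a ≤ n ∧ m < (k + 1) ^ b) ∧ k ≤ m := by
      by_cases hk : k₀ ≤ m
      · exact ⟨k₀, h, hk⟩
      · exact ⟨m, ⟨(Nat.pow_le_pow_left (by omega) a).trans h.1,
          Nat.lt_of_lt_of_le m.lt_succ_self (Nat.le_self_pow hb.ne' _)⟩, le_rfl⟩
    have hk : 0 < k := by
      rcases Nat.eq_zero_or_pos k with rfl | h0
      · simp at hkb; omega
      · exact h0
    have hkn : k ≤ n := (Nat.le_self_pow ha.ne' k).trans hka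
    have htrue : ∀ β : ℕ, (fun _ _ => true : ℕ → ℕ → Bool) =
        fun _ j => decide (β ^ 0 ∣ j + 1) := by
      intro β
      simp
    refine ⟨fun i => decide (i < k), fun j => decide (j < k), rowsInject_of_lt hm hkm, ?_, ?_⟩
    · rw [htrue k]
      -- Rows are numbered from 0, so the multiple `k ^ a` of itself sits in row `k ^ a - 1`.
      refine countChain_of_pow hk hkm le_rfl (Nat.le_succ k) a 0 fun i _ => ⟨k ^ a - 1, ?_, ?_⟩
      · have := pow_pos hk a
        omega
      · have : k ^ a - 1 + 1 = k ^ a := Nat.sub_add_cancel (pow_pos hk a)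
        simp [this]
    · rw [htrue (k + 1)]
      refine countChain_of_pow hk hkn (Nat.le_succ k) le_rfl b 0 fun i _ j hj => ?_
      rw [zero_add, decide_eq_false_iff_not]
      intro hdvd
      have : (k + 1) ^ b ≤ j + 1 := Nat.le_of_dvd (Nat.succ_pos _) hdvd
      omega

/-! ### The function, its epigraph and its growth. -/

/-- The function `n ↦ ⌊n ^ (1 / b)⌋ ^ a`. -/
noncomputable def floorRootPow (a b : ℕ) (n : ℕ+) : ℕ+ :=
  ⟨⌊((n : ℕ) : ℝ) ^ ((1 : ℝ) / (b : ℝ))⌋₊ ^ a, by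
    refine pow_pos (Nat.floor_pos.2 (Real.one_le_rpow ?_ (by positivity))) a
    exact_mod_cast n.pos⟩

theorem floorRootPow_le_iff {a b : ℕ} (hb : 0 < b) (m n : ℕ+) :
    floorRootPow a b m ≤ n ↔ ∃ k : ℕ, k ^ a ≤ n ∧ (m : ℕ) < (k + 1) ^ b := by
  rw [← PNat.coe_le_coe]
  change ⌊((m : ℕ) : ℝ) ^ ((1 : ℝ) / (b : ℝ))⌋₊ ^ a ≤ (n : ℕ) ↔ _
  have hlt : ∀ k : ℕ, (m : ℕ) < (k + 1) ^ b ↔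
      ((m : ℕ) : ℝ) ^ ((1 : ℝ) / (b : ℝ)) < k + 1 := by
    intro k
    rw [one_div, Real.rpow_inv_lt_iff_of_pos (by positivity) (by positivity) (by positivity),
      Real.rpow_natCast]
    exact_mod_cast Iff.rfl
  constructor
  · exact fun h => ⟨_, h, (hlt _).2 (Nat.lt_floor_add_one _)⟩
  · rintro ⟨k, hka, hkb⟩
    refine (Nat.pow_le_pow_left (Nat.lt_succ_iff.1 ?_) a).trans hka
    rw [Nat.floor_lt (by positivity)]
    exact_mod_cast (hlt k).1 hkb

theorem isRecognizableSet_epigraph_floorRootPow {a b : ℕ} (ha : 0 < a) (hb : 0 < b) :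
    IsRecognizableSet (epigraph (floorRootPow a b)) :=
  isRecognizableSet_of_rec (rec_powerCondition a b) fun m n =>
    (floorRootPow_le_iff hb m n).trans (powerCondition_iff ha hb m.pos n.pos).symm

/-- The quotient is the `a`-th power of `⌊x⌋ / x` at `x = n ^ (1 / b)`, which tends to infinity. -/
theorem asympEqual_floorRootPow (a : ℕ) {b : ℕ} (hb : 0 < b) :
    AsympEqual (fun n => ((floorRootPow a b n : ℕ) : ℝ))
      (fun n => ((n : ℕ) : ℝ) ^ ((a : ℝ) / (b : ℝ))) := by
  have hroot : Tendsto (fun n : ℕ+ => ((n : ℕ) : ℝ) ^ ((1 : ℝ) / (b : ℝ))) atTop atTop :=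
    (tendsto_rpow_atTop (by positivity)).comp
      (tendsto_natCast_atTop_atTop.comp tendsto_PNat_val_atTop_atTop)
  have h := ((tendsto_nat_floor_div_atTop (R := ℝ)).comp hroot).pow a
  rw [one_pow] at h
  refine h.congr fun n => ?_
  change _ = ((⌊((n : ℕ) : ℝ) ^ ((1 : ℝ) / (b : ℝ))⌋₊ ^ a : ℕ) : ℝ) / _
  dsimp only
  rw [div_eq_mul_one_div (a : ℝ), mul_comm (a : ℝ), Real.rpow_mul (by positivity),
    Real.rpow_natCast, Nat.cast_pow, ← div_pow]
  rfl

end PictureLanguage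

theorem mainTheorem7 (r : ℚ) (hr : 0 < r) :
    (∃ f : ℕ+ → ℕ+,
      PictureLanguage.AsympEqual (fun n => ((f n : ℕ) : ℝ)) (fun n => ((n : ℕ) : ℝ) ^ (r : ℝ)) ∧
      PictureLanguage.IsRecognizableSet (PictureLanguage.epigraph f)) ∧
    (∀ a b : ℕ, 0 < a → 0 < b → r = (a : ℚ) / (b : ℚ) →
      ∃ f : ℕ+ → ℕ+,
        (∀ n : ℕ+, (f n : ℕ) = ⌊((n : ℕ) : ℝ) ^ ((1 : ℝ) / (b : ℝ))⌋₊ ^ a) ∧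
        PictureLanguage.AsympEqual (fun n => ((f n : ℕ) : ℝ)) (fun n => ((n : ℕ) : ℝ) ^ (r : ℝ)) ∧
        PictureLanguage.IsRecognizableSet (PictureLanguage.epigraph f)) := by
  have key : ∀ a b : ℕ, 0 < a → 0 < b → r = (a : ℚ) / (b : ℚ) →
      ∃ f : ℕ+ → ℕ+,
        (∀ n : ℕ+, (f n : ℕ) = ⌊((n : ℕ) : ℝ) ^ ((1 : ℝ) / (b : ℝ))⌋₊ ^ a) ∧
        PictureLanguage.AsympEqual (fun n => ((f n : ℕ) : ℝ)) (fun n => ((n : ℕ) : ℝ) ^ (r : ℝ)) ∧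
        PictureLanguage.IsRecognizableSet (PictureLanguage.epigraph f) := by
    intro a b ha hb hab
    have hab' : (r : ℝ) = (a : ℝ) / (b : ℝ) := by rw [hab]; push_cast; rfl
    rw [hab']
    exact ⟨_, fun _ => rfl, PictureLanguage.asympEqual_floorRootPow a hb,
      PictureLanguage.isRecognizableSet_epigraph_floorRootPow ha hb⟩
  refine ⟨?_, key⟩
  have hnum : 0 < r.num := Rat.num_pos.2 hr
  obtain ⟨f, -, hf⟩ := key r.num.toNat r.den (by omega) r.pos (by
    have : ((r.num.toNat : ℕ) : ℚ) = (r.num : ℚ) := by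
      exact_mod_cast congrArg (Int.cast : ℤ → ℚ) (Int.toNat_of_nonneg hnum.le)
    rw [this, Rat.num_div_den])
  exact ⟨f, hf⟩
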